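/- **Conventions.** Write $\mathbb R^2_>=\{(r_1,r_2)\in\mathbb R^2: r_1<r_2\}$ with the Euclidean norm, $\Delta$ for the diagonal of $\mathbb R^2$ and $\mathrm{pers}(r)=r_2-r_1$. Let $\mathbb X$ be a compact metric space. For $f:\mathbb X\to\mathbb R$ let $\mathrm{dgm}_q[f]$ be the multiset of points of $\mathbb R^2_>$ in the $q$-th persistence diagram (homology with coefficients in $\mathbb F_2$; points at infinity are not recorded) of the filtration by sublevel sets $\{f\le t\}$, $t\in\mathbb R$. The function $f$ is *tame* if, in every degree $q$, this diagram exists (i.e. $H_q(\{f\le s\})\to H_q(\{f\le t\})$ has finite rank for all $s<t$) and is finite. For a finite multiset $D$ in $\mathbb R^2_>$ put $\mathrm{Pers}_t(D)=\sum_{r\in D}\mathrm{pers}(r)^t$. For $1\le p\le\infty$, $$W_p(D,D')=\min_\gamma\Big(\sum_{r\in D\cup\Delta}\|r-\gamma(r)\|^p\Big)^{1/p}$$ over bijections $\gamma:D\cup\Delta\to D'\cup\Delta$, each point of $\Delta$ being counted with infinite multiplicity (with a supremum in place of the sum if $p=\infty$). Let $m\ge1$ and $q_0\in\mathbb N$.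 We say that $\mathbb X$ has *bounded $m$-th total persistence in degrees $\ge q_0$, with constant $C_{\mathbb X,m}$*, if $\mathrm{Pers}_m(\mathrm{dgm}_q[f])\le C_{\mathbb X,m}$ for all tame $1$-Lipschitz $f:\mathbb X\to\mathbb R$ and all $q\ge q_0$. For $A>0$, $\alpha\ge1$ let $\mathbb W(\alpha,A)$ be the class of functions $w(r)=\tilde w(\mathrm{pers}(r))$ on $\mathbb R^2_>$ with $\tilde w:\mathbb R_+\to\mathbb R_+$ differentiable, $\tilde w(0)=0$ and $|\tilde w'(u)|\le Au^{\alpha-1}$ for all $u\ge0$. For a bounded Lipschitz map $\phi:\mathbb R^2_>\to\mathcal B$ into a real Banach space let $\Phi_w(D)=\sum_{r\in D}w(r)\phi(r)$. $\mathrm{Lip}(\cdot)$ denotes the smallest Lipschitz constant and $\|\phi\|_\infty=\sup_r\|\phi(r)\|_{\mathcal B}$. **Corollary.** Let $\mathbb X$ be a compact triangulable metric space which has bounded $m$-th total persistence in degrees $\ge q_0$ with constant $C_{\mathbb X,m}$, for some $m\ge1$ and $q_0\ge 0$. Let $q\ge q_0$, $A>0$, $\alpha\ge1$, $w\in\mathbb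 W(\alpha,A)$, let $\phi$ be a bounded Lipschitz map as above, and let $m\le p\le\infty$ (with $1/\infty=0$). (i) Let $a\in[0,1]$ with $\alpha\ge m+a\left(1-\frac mp\right)$, and let $f,g:\mathbb X\to\mathbb R$ be tame Lipschitz functions. Put $C_0=C_{\mathbb X,m}\max\{\mathrm{Lip}(f)^m,\mathrm{Lip}(g)^m\}$ and let $\ell$ be the maximal persistence of the points of the two diagrams $\mathrm{dgm}_q[f],\mathrm{dgm}_q[g]$ ($\ell=0$ if both are empty). Then, with $0^0=1$, $$\|\Phi_w(\mathrm{dgm}_q[f])-\Phi_w(\mathrm{dgm}_q[g])\|_{\mathcal B}\le C_1\,W_p(\mathrm{dgm}_q[f],\mathrm{dgm}_q[g])+C_2\,W_p(\mathrm{dgm}_q[f],\mathrm{dgm}_q[g])^a,$$ where $$C_1=\mathrm{Lip}(\phi)\,\frac A\alpha\,\ell^{\,\alpha-m\left(1-\frac1p\right)}\,C_0^{\,1-\frac1p},\qquad C_2=2^{a/2}\,\|\phi\|_\infty\,A\,\ell^{\,\alpha-m-a\left(1-\frac mp\right)}\,(2C_0)^{\,1-\frac ap}.$$ (ii) In particular,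 if $\alpha>m$, the representations are Hölder continuous: for every $L\ge0$ there is a constant $K$ such that for all tame $L$-Lipschitz functions $f,g:\mathbb X\to\mathbb R$ $$\|\Phi_w(\mathrm{dgm}_q[f])-\Phi_w(\mathrm{dgm}_q[g])\|_{\mathcal B}\le K\,W_p(\mathrm{dgm}_q[f],\mathrm{dgm}_q[g])^{\min(1,\alpha-m)}.$$ -/

import Mathlib

open CategoryTheory
open scoped ENNReal NNReal

noncomputable section

universe u

namespace Persistence

/-! ### Singular homology of sublevel sets, with coefficients in the field with two elements -/

/-- The field `𝔽₂`, as a module over itself in the universe of the space. -/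
abbrev F2 : ModuleCat.{u} (ZMod 2) := ModuleCat.of (ZMod 2) (ULift.{u} (ZMod 2))

/-- Singular homology `H_q(S; 𝔽₂)` of a subset `S` of a topological space. -/
abbrev subsetHomology {X : Type u} [TopologicalSpace X] (q : ℕ) (S : Set X) :
    ModuleCat.{u} (ZMod 2) :=
  ((AlgebraicTopology.singularHomologyFunctor (ModuleCat.{u} (ZMod 2)) q).obj F2.{u}).obj
    (TopCat.of S)

/-- The linear map `H_q(S; 𝔽₂) → H_q(T; 𝔽₂)` induced by an inclusion `S ⊆ T`. -/
def homologyInclusion {X : Type u} [TopologicalSpace X] (q : ℕ) {S T : Set X} (h : S ⊆ T) :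
    subsetHomology q S →ₗ[ZMod 2] subsetHomology q T :=
  (((AlgebraicTopology.singularHomologyFunctor (ModuleCat.{u} (ZMod 2)) q).obj F2.{u}).map
    (TopCat.ofHom ⟨Set.inclusion h, continuous_inclusion h⟩)).hom

/-- The sublevel set `{f ≤ t}`. -/
def sublevel {X : Type u} (f : X → ℝ) (t : ℝ) : Set X := {x | f x ≤ t}

theorem sublevel_mono {X : Type u} (f : X → ℝ) {s t : ℝ} (h : s ≤ t) :
    sublevel f s ⊆ sublevel f t := fun _ hx => le_trans hx h

/-- The map `H_q(f ≤ s) → H_q(f ≤ t)` of the sublevel set filtration, for `s ≤ t`. -/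
def sublevelMap {X : Type u} [TopologicalSpace X] (f : X → ℝ) (q : ℕ) {s t : ℝ} (h : s ≤ t) :
    subsetHomology q (sublevel f s) →ₗ[ZMod 2] subsetHomology q (sublevel f t) :=
  homologyInclusion q (sublevel_mono f h)

/-- The rank of `H_q(f ≤ s) → H_q(f ≤ t)` (persistent Betti number); only used for `s ≤ t`. -/
def persistentRank {X : Type u} [TopologicalSpace X] (f : X → ℝ) (q : ℕ) (s t : ℝ) : ℕ :=
  open Classical in
  if h : s ≤ t then Module.finrank (ZMod 2) (LinearMap.range (sublevelMap f q h)) else 0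

/-! ### Persistence diagrams -/

/-- The Euclidean plane. -/
abbrev Plane : Type := EuclideanSpace ℝ (Fin 2)

/-- The open half-plane `{(r₁, r₂) : r₁ < r₂}` above the diagonal, with the Euclidean metric. -/
abbrev HalfPlane : Type := {r : Plane // r 0 < r 1}

/-- The diagonal of the plane. -/
abbrev Diagonal : Type := {r : Plane // r 0 = r 1}

/-- The persistence `r₂ - r₁` of a point. -/
def pers (r : HalfPlane) : ℝ := r.1 1 - r.1 0

/-- The number of homology classes that are born in `(b, b']` and die in `(d, d']`, expressed
through ranks by inclusion-exclusion; only used for `b < b' < d < d'`. -/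
def rectangleCount {X : Type u} [TopologicalSpace X] (f : X → ℝ) (q : ℕ) (b b' d d' : ℝ) : ℤ :=
  (persistentRank f q b' d : ℤ) - persistentRank f q b d
    - persistentRank f q b' d' + persistentRank f q b d'

/-- The multiplicity of the point `r` in the `q`-th persistence diagram of the sublevel sets
of `f`: the smallest count of a square `[r₁ - ε, r₁ + ε] × [r₂ - ε, r₂ + ε]` that lies
above the diagonal. -/
def multiplicity {X : Type u} [TopologicalSpace X] (f : X → ℝ) (q : ℕ) (r : HalfPlane) : ℕ :=
  sInf {k : ℕ | ∃ ε : ℝ, 0 < ε ∧ r.1 0 + ε < r.1 1 - ε ∧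
    k = (rectangleCount f q (r.1 0 - ε) (r.1 0 + ε) (r.1 1 - ε) (r.1 1 + ε)).toNat}

/-- Tameness: in every degree the persistence diagram exists (the maps
`H_q(f ≤ s) → H_q(f ≤ t)` have finite rank for `s < t`) and is finite. -/
def Tame {X : Type u} [TopologicalSpace X] (f : X → ℝ) : Prop :=
  ∀ q : ℕ,
    (∀ (s t : ℝ) (h : s < t),
      Module.Finite (ZMod 2) (LinearMap.range (sublevelMap f q h.le))) ∧
    {r : HalfPlane | multiplicity f q r ≠ 0}.Finite

/-- The space of persistence diagrams: finite multisets of points above the diagonal. -/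
abbrev Diagram : Type := Multiset HalfPlane

/-- The `q`-th persistence diagram of the sublevel set filtration of a tame function (its points
in the half-plane; points at infinity are not recorded). -/
def dgm {X : Type u} [TopologicalSpace X] (f : X → ℝ) (q : ℕ) : Diagram :=
  ∑ᶠ r : HalfPlane, Multiset.replicate (multiplicity f q r) r

/-- The total persistence of degree `t`: the sum of `pers r ^ t` over the diagram. -/
def totalPers (t : ℝ) (D : Diagram) : ℝ := (D.map fun r => pers r ^ t).sum

/-- The maximal persistence of the points of two diagrams (zero if both are empty). -/
def maxPers (D D' : Diagram) : ℝ := sSup {x : ℝ | ∃ r ∈ D + D', pers r = x}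

/-! ### Wasserstein distances -/

/-- The index set of `D ∪ Δ`: the points of `D`, repeated according to their multiplicity,
together with the points of the diagonal, each counted with infinite multiplicity. -/
abbrev Augmented (D : Diagram) : Type :=
  open Classical in D.ToType ⊕ (Diagonal × ℕ)

/-- The point of the plane that an index of `D ∪ Δ` stands for. -/
def Augmented.point {D : Diagram} : Augmented D → Plane
  | Sum.inl x => x.1.1
  | Sum.inr y => y.1.1

/-- The cost of a bijection `γ : D ∪ Δ → D' ∪ Δ`, i.e. the `ℓ^p`-norm of the displacements. -/
def matchingCost (p : ℝ≥0∞) {D D' : Diagram} (γ : Augmented D ≃ Augmented D') : ℝ≥0∞ :=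
  open Classical in
  if p = ∞ then ⨆ x, edist x.point (γ x).point
  else (∑' x, edist x.point (γ x).point ^ p.toReal) ^ (1 / p.toReal)

/-- The Wasserstein distance `W_p` between two diagrams, for `1 ≤ p ≤ ∞` (the bottleneck
distance for `p = ∞`). -/
def wassersteinDist (p : ℝ≥0∞) (D D' : Diagram) : ℝ :=
  (⨅ γ : Augmented D ≃ Augmented D', matchingCost p γ).toReal

/-! ### Spaces with bounded total persistence -/

/-- A compact space is triangulable if it is homeomorphic to (the underlying space of) a finite
simplicial complex. -/
def Triangulable (X : Type u) [TopologicalSpace X] : Prop :=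
  ∃ (n : ℕ) (K : Geometry.SimplicialComplex ℝ (EuclideanSpace ℝ (Fin n))),
    K.faces.Finite ∧ Nonempty (X ≃ₜ K.space)

/-- `X` has bounded `m`-th total persistence in the homological degrees `q ≥ q₀`, with the
constant `C`. -/
def BoundedTotalPersistence (X : Type u) [MetricSpace X] (m : ℝ) (q₀ : ℕ) (C : ℝ) : Prop :=
  ∀ f : X → ℝ, Tame f → LipschitzWith 1 f → ∀ q : ℕ, q₀ ≤ q → totalPers m (dgm f q) ≤ C

/-! ### Linear representations -/

/-- The (smallest) Lipschitz constant of a Lipschitz function. -/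
def lipConst {X Y : Type*} [PseudoMetricSpace X] [PseudoMetricSpace Y] (f : X → Y) : ℝ :=
  ((sInf {K : ℝ≥0 | LipschitzWith K f} : ℝ≥0) : ℝ)

/-- The supremum norm of a bounded function. -/
def supNorm {X B : Type*} [NormedAddCommGroup B] (φ : X → B) : ℝ := ⨆ x, ‖φ x‖

/-- The class `𝕎(α, A)` of weight functions `w(r) = v(pers r)`, where `v : ℝ₊ → ℝ₊` is
differentiable with `v(0) = 0` and `|v'(u)| ≤ A u ^ (α - 1)` for all `u ≥ 0`. -/
def weightClass (α A : ℝ) : Set (HalfPlane → ℝ) :=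
  {w | ∃ v : ℝ → ℝ, DifferentiableOn ℝ v (Set.Ici 0) ∧ (∀ u, 0 ≤ u → 0 ≤ v u) ∧ v 0 = 0 ∧
    (∀ u, 0 ≤ u → |derivWithin v (Set.Ici 0) u| ≤ A * u ^ (α - 1)) ∧
    ∀ r, w r = v (pers r)}

/-- The linear representation `Φ_w(D) = D(w φ)`, the sum of `w(r) φ(r)` over the points
of the diagram. -/
def representation {B : Type*} [NormedAddCommGroup B] [NormedSpace ℝ B]
    (w : HalfPlane → ℝ) (φ : HalfPlane → B) (D : Diagram) : B :=
  (D.map fun r => w r • φ r).sum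

end Persistence

end

/-!
# Stability of linear representations of persistence diagrams

Fix a bijection `γ` between `D ∪ Δ` and `D' ∪ Δ`. Since the weight vanishes on the diagonal, the
difference of the two representations is a finite sum over the matched pairs `(x, y)` of
`w x φ x - w y φ y = w x (φ x - φ y) + (w x - w y) φ y`
(`norm_smul_value_sub_le`). The weight grows at most like `(A / α) pers ^ α` (`weight_le`), and by the
mean value inequality its increments satisfy
`|w x - w y| ≤ A max (pers x) (pers y) ^ (α - a) * |pers x - pers y| ^ a` for `0 ≤ a ≤ 1`
(`abs_weight_sub_le`), where `|pers x - pers y| ≤ √2 ‖x - y‖`. Hence both parts are sums of products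
of a power of a persistence and a power, `1` or `a`, of a displacement. Hölder's inequality
separates the two: the displacements give the cost of `γ`, and the persistences give the total
persistence of degree `m`, up to a power of the maximal persistence
(`sum_rpow_mul_rpow_le_of_cost`). Passing to the infimum over `γ` gives the estimate
`norm_representation_sub_le` for arbitrary diagrams; here one needs a matching of finite cost,
as otherwise the real-valued distance would be the junk value zero (`exists_matchingCost_ne_top`).

For diagrams of Lipschitz functions, the total persistence is controlled by rescaling the
function to a `1`-Lipschitz one, which dilates its diagram (`dgm_const_mul`,
`BoundedTotalPersistence.totalPers_le`). For the Hölder continuity when `m < α`, take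
`a = min 1 (α - m)`: if `W ≤ 1` then `W ≤ W ^ a`, so that the term linear in `W` is absorbed, and if
`W ≥ 1` then the boundedness of the representations suffices (`norm_representation_le`).
-/

universe u

namespace Persistence

/-! ### Total persistence of Lipschitz functions -/

theorem finrank_range_homologyInclusion_congr {X : Type u} [TopologicalSpace X] (q : ℕ)
    {S T S' T' : Set X} (hS : S = S') (hT : T = T') (h : S ⊆ T) (h' : S' ⊆ T') :
    Module.finrank (ZMod 2) (LinearMap.range (homologyInclusion q h)) =
      Module.finrank (ZMod 2) (LinearMap.range (homologyInclusion q h')) := by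
  subst hS hT; rfl

theorem finite_range_homologyInclusion_congr {X : Type u} [TopologicalSpace X] (q : ℕ)
    {S T S' T' : Set X} (hS : S = S') (hT : T = T') (h : S ⊆ T) (h' : S' ⊆ T')
    (H : Module.Finite (ZMod 2) (LinearMap.range (homologyInclusion q h))) :
    Module.Finite (ZMod 2) (LinearMap.range (homologyInclusion q h')) := by
  subst hS hT; exact H

theorem sublevel_const_mul {X : Type u} (f : X → ℝ) {c : ℝ} (hc : 0 < c) (t : ℝ) :
    sublevel (fun x => c * f x) (c * t) = sublevel f t := by
  ext x
  exact mul_le_mul_iff_right₀ hc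

theorem persistentRank_const_mul {X : Type u} [TopologicalSpace X] (f : X → ℝ) (q : ℕ) {c : ℝ}
    (hc : 0 < c) (s t : ℝ) :
    persistentRank (fun x => c * f x) q (c * s) (c * t) = persistentRank f q s t := by
  unfold persistentRank
  by_cases h : s ≤ t
  · have h' : c * s ≤ c * t := mul_le_mul_of_nonneg_left h hc.le
    rw [dif_pos h, dif_pos h']
    exact finrank_range_homologyInclusion_congr q (sublevel_const_mul f hc s)
      (sublevel_const_mul f hc t) _ _
  · have h' : ¬ c * s ≤ c * t := by rwa [mul_le_mul_iff_right₀ hc]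
    rw [dif_neg h, dif_neg h']

theorem rectangleCount_const_mul {X : Type u} [TopologicalSpace X] (f : X → ℝ) (q : ℕ) {c : ℝ}
    (hc : 0 < c) (b b' d d' : ℝ) :
    rectangleCount (fun x => c * f x) q (c * b) (c * b') (c * d) (c * d') =
      rectangleCount f q b b' d d' := by
  simp only [rectangleCount, persistentRank_const_mul f q hc]

/-- The dilation of the open half-plane above the diagonal by a positive factor. -/
noncomputable def dilation (c : ℝ) (hc : 0 < c) : HalfPlane ≃ HalfPlane where
  toFun r := ⟨c • r.1, by simpa using mul_lt_mul_of_pos_left r.2 hc⟩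
  invFun r := ⟨c⁻¹ • r.1, by simpa using mul_lt_mul_of_pos_left r.2 (inv_pos.2 hc)⟩
  left_inv r := Subtype.ext (inv_smul_smul₀ hc.ne' r.1)
  right_inv r := Subtype.ext (smul_inv_smul₀ hc.ne' r.1)

theorem pers_pos (r : HalfPlane) : 0 < pers r := sub_pos.2 r.2

theorem pers_dilation {c : ℝ} (hc : 0 < c) (r : HalfPlane) :
    pers (dilation c hc r) = c * pers r := by
  simp [pers, dilation, mul_sub]

theorem multiplicity_const_mul {X : Type u} [TopologicalSpace X] (f : X → ℝ) (q : ℕ) {c : ℝ}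
    (hc : 0 < c) (r : HalfPlane) :
    multiplicity (fun x => c * f x) q (dilation c hc r) = multiplicity f q r := by
  unfold multiplicity
  have h0 : (dilation c hc r).1 0 = c * r.1 0 := by simp [dilation]
  have h1 : (dilation c hc r).1 1 = c * r.1 1 := by simp [dilation]
  rw [h0, h1]
  congr 1
  ext k
  constructor
  · rintro ⟨ε, hε, h, rfl⟩
    obtain ⟨δ, rfl⟩ : ∃ δ, ε = c * δ := ⟨c⁻¹ * ε, by field_simp⟩
    simp only [← mul_add, ← mul_sub, rectangleCount_const_mul f q hc] at h ⊢
    exact ⟨δ, pos_of_mul_pos_right hε hc.le, (mul_lt_mul_iff_right₀ hc).1 h, rfl⟩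
  · rintro ⟨ε, hε, h, rfl⟩
    refine ⟨c * ε, mul_pos hc hε, ?_, ?_⟩
    · simpa only [← mul_add, ← mul_sub] using mul_lt_mul_of_pos_left h hc
    · simp only [← mul_add, ← mul_sub, rectangleCount_const_mul f q hc]

theorem Tame.const_mul {X : Type u} [TopologicalSpace X] {f : X → ℝ} (hf : Tame f) {c : ℝ}
    (hc : 0 < c) : Tame fun x => c * f x := by
  intro q
  constructor
  · intro s t h
    obtain ⟨s, rfl⟩ : ∃ s', s = c * s' := ⟨c⁻¹ * s, by field_simp⟩
    obtain ⟨t, rfl⟩ : ∃ t', t = c * t' := ⟨c⁻¹ * t, by field_simp⟩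
    exact finite_range_homologyInclusion_congr q (sublevel_const_mul f hc s).symm
      (sublevel_const_mul f hc t).symm _ _ ((hf q).1 s t ((mul_lt_mul_iff_right₀ hc).1 h))
  · refine ((hf q).2.image (dilation c hc)).subset fun r hr => ?_
    refine ⟨(dilation c hc).symm r, ?_, Equiv.apply_symm_apply _ _⟩
    rw [Set.mem_ofPred_eq, ← multiplicity_const_mul f q hc, Equiv.apply_symm_apply]
    exact hr

theorem dgm_const_mul {X : Type u} [TopologicalSpace X] {f : X → ℝ} (hf : Tame f) (q : ℕ) {c : ℝ}
    (hc : 0 < c) :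
    dgm (fun x => c * f x) q = (dgm f q).map (dilation c hc) := by
  unfold dgm
  rw [← Multiset.coe_mapAddMonoidHom, AddMonoidHom.map_finsum]
  · rw [← finsum_comp_equiv (dilation c hc)]
    simp only [multiplicity_const_mul f q hc, Multiset.coe_mapAddMonoidHom,
      Multiset.map_replicate]
  · refine (hf q).2.subset fun r hr h0 => hr ?_
    simp [h0]

theorem totalPers_map_dilation (t : ℝ) (D : Diagram) {c : ℝ} (hc : 0 < c) :
    totalPers t (D.map (dilation c hc)) = c ^ t * totalPers t D := by
  simp only [totalPers, Multiset.map_map, Function.comp_def, pers_dilation,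
    Real.mul_rpow hc.le (pers_pos _).le, Multiset.sum_map_mul_left]

theorem totalPers_nonneg (t : ℝ) (D : Diagram) : 0 ≤ totalPers t D := by
  refine Multiset.sum_nonneg fun x hx => ?_
  obtain ⟨r, -, rfl⟩ := Multiset.mem_map.1 hx
  exact Real.rpow_nonneg (pers_pos r).le t

/-- The bound on total persistence for `1`-Lipschitz functions rescales to `K`-Lipschitz functions,
including `K = 0`: then every positive constant is a Lipschitz constant, and `K ^ m → 0`. -/
theorem BoundedTotalPersistence.totalPers_le {X : Type u} [MetricSpace X] {m : ℝ} (hm : 0 < m)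
    {q₀ q : ℕ} {C : ℝ} (hC : BoundedTotalPersistence X m q₀ C) (hq : q₀ ≤ q) {f : X → ℝ}
    (hf : Tame f) {K : ℝ≥0} (hK : LipschitzWith K f) :
    totalPers m (dgm f q) ≤ C * (K : ℝ) ^ m := by
  have key : ∀ K' : ℝ, (K : ℝ) < K' → totalPers m (dgm f q) ≤ C * K' ^ m := by
    intro K' hK'
    have h0 : 0 < K' := K.2.trans_lt hK'
    have hLip : LipschitzWith 1 fun x => K'⁻¹ * f x := by
      refine LipschitzWith.of_dist_le_mul fun x y => ?_
      rw [Real.dist_eq, ← mul_sub, abs_mul, abs_of_pos (inv_pos.2 h0), ← Real.dist_eq]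
      calc K'⁻¹ * dist (f x) (f y) ≤ K'⁻¹ * (K' * dist x y) := by
            gcongr
            exact (hK.dist_le_mul x y).trans (by gcongr)
        _ = (1 : ℝ≥0) * dist x y := by
            rw [inv_mul_cancel_left₀ h0.ne', NNReal.coe_one, one_mul]
    have h := hC _ (hf.const_mul (inv_pos.2 h0)) hLip q hq
    rwa [dgm_const_mul hf q (inv_pos.2 h0), totalPers_map_dilation, Real.inv_rpow h0.le,
      inv_mul_le_iff₀ (Real.rpow_pos_of_pos h0 m), mul_comm] at h
  have hcont : Filter.Tendsto (fun K' : ℝ => C * K' ^ m) (nhdsWithin (K : ℝ) (Set.Ioi (K : ℝ)))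
      (nhds (C * (K : ℝ) ^ m)) :=
    ((Real.continuous_rpow_const hm.le).const_mul C).continuousAt.mono_left nhdsWithin_le_nhds
  exact ge_of_tendsto hcont (Filter.eventually_of_mem self_mem_nhdsWithin key)

theorem pers_rpow_le_totalPers (t : ℝ) {D : Diagram} {r : HalfPlane} (hr : r ∈ D) :
    pers r ^ t ≤ totalPers t D := by
  refine Multiset.single_le_sum (fun x hx => ?_) _ (Multiset.mem_map_of_mem _ hr)
  obtain ⟨r, -, rfl⟩ := Multiset.mem_map.1 hx
  exact Real.rpow_nonneg (pers_pos r).le t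

theorem pers_le_maxPers {D D' : Diagram} {r : HalfPlane} (hr : r ∈ D + D') :
    pers r ≤ maxPers D D' := by
  classical
  refine le_csSup (Set.Finite.bddAbove ?_) ⟨r, hr, rfl⟩
  refine ((D + D').toFinset.finite_toSet.image pers).subset ?_
  rintro x ⟨r, hr, rfl⟩
  exact ⟨r, by simpa using hr, rfl⟩

theorem maxPers_nonneg (D D' : Diagram) : 0 ≤ maxPers D D' := by
  refine Real.sSup_nonneg ?_
  rintro x ⟨r, -, rfl⟩
  exact (pers_pos r).le

/-! ### Lipschitz constants and supremum norms -/

/-- The infimum of the Lipschitz constants is itself a Lipschitz constant. -/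
theorem lipschitzWith_sInf {X Y : Type*} [PseudoMetricSpace X] [PseudoMetricSpace Y] {f : X → Y}
    (hf : ∃ K : ℝ≥0, LipschitzWith K f) :
    LipschitzWith (sInf {K : ℝ≥0 | LipschitzWith K f}) f := by
  refine LipschitzWith.of_dist_le_mul fun x y => ?_
  refine ge_of_tendsto (x := nhdsWithin (sInf {K : ℝ≥0 | LipschitzWith K f})
    (Set.Ioi (sInf {K : ℝ≥0 | LipschitzWith K f}))) (f := fun K : ℝ≥0 => (K : ℝ) * dist x y)
    ((NNReal.continuous_coe.mul continuous_const).continuousAt.mono_left nhdsWithin_le_nhds)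
    (Filter.eventually_of_mem self_mem_nhdsWithin fun K hK => ?_)
  obtain ⟨K', hK', hlt⟩ := exists_lt_of_csInf_lt hf hK
  have hLip : LipschitzWith K' f := hK'
  exact (hLip.dist_le_mul x y).trans (by gcongr)

theorem lipConst_nonneg {X Y : Type*} [PseudoMetricSpace X] [PseudoMetricSpace Y] (f : X → Y) :
    0 ≤ lipConst f := NNReal.coe_nonneg _

theorem supNorm_nonneg {X B : Type*} [NormedAddCommGroup B] (φ : X → B) : 0 ≤ supNorm φ :=
  Real.iSup_nonneg fun _ => norm_nonneg _

theorem norm_le_supNorm {X B : Type*} [NormedAddCommGroup B] {φ : X → B}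
    (hφ : ∃ M : ℝ, ∀ r, ‖φ r‖ ≤ M) (r : X) : ‖φ r‖ ≤ supNorm φ := by
  obtain ⟨M, hM⟩ := hφ
  refine le_ciSup (f := fun x => ‖φ x‖) ⟨M, ?_⟩ r
  rintro _ ⟨x, rfl⟩
  exact hM x

/-! ### Hölder's inequality for matched persistences -/

theorem sum_rpow_mul_rpow_le {ι : Type*} (s : Finset ι) {x y : ι → ℝ} {t : ℝ} (ht : 0 ≤ t)
    (ht' : t ≤ 1) (hx : ∀ i ∈ s, 0 ≤ x i) (hy : ∀ i ∈ s, 0 ≤ y i) :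
    ∑ i ∈ s, x i ^ (1 - t) * y i ^ t ≤ (∑ i ∈ s, x i) ^ (1 - t) * (∑ i ∈ s, y i) ^ t := by
  rcases ht.eq_or_lt with rfl | ht0
  · simp
  rcases ht'.eq_or_lt with rfl | ht1
  · simp
  have hpq : (1 - t)⁻¹.HolderConjugate t⁻¹ := by
    rw [Real.holderConjugate_iff]
    exact ⟨(one_lt_inv₀ (by linarith)).2 (by linarith), by simp⟩
  have h := Real.inner_le_Lp_mul_Lq_of_nonneg s hpq
    (fun i hi => Real.rpow_nonneg (hx i hi) (1 - t)) (fun i hi => Real.rpow_nonneg (hy i hi) t)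
  have e1 : ∑ i ∈ s, (x i ^ (1 - t)) ^ (1 - t)⁻¹ = ∑ i ∈ s, x i :=
    Finset.sum_congr rfl fun i hi => Real.rpow_rpow_inv (hx i hi) (by linarith)
  have e2 : ∑ i ∈ s, (y i ^ t) ^ t⁻¹ = ∑ i ∈ s, y i :=
    Finset.sum_congr rfl fun i hi => Real.rpow_rpow_inv (hy i hi) ht0.ne'
  rwa [e1, e2, one_div, one_div, inv_inv, inv_inv] at h

/-- Hölder's inequality for persistences `h` and displacements `d`: a sum of `h ^ β * d ^ a` is
bounded by the `ℓ^p`-norm of `d`, the sum of `h ^ m`, and the maximum of `h`, which takes up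
the part of the exponent `β` that is left over. -/
theorem sum_rpow_mul_rpow_le_of_cost {ι : Type*} (s : Finset ι) {h d : ι → ℝ} {p : ℝ≥0∞}
    (hp : 1 ≤ p) {m β a l S c : ℝ} (hm : 0 < m) (ha : 0 ≤ a) (ha' : a ≤ 1) (hl : 0 ≤ l)
    (hc : 0 ≤ c) (hβ : m * (1 - a * (1 / p).toReal) ≤ β) (hh : ∀ i ∈ s, 0 ≤ h i)
    (hhl : ∀ i ∈ s, h i ≤ l) (hd : ∀ i ∈ s, 0 ≤ d i) (hS : ∑ i ∈ s, h i ^ m ≤ S)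
    (hsup : p = ∞ → ∀ i ∈ s, d i ≤ c)
    (hsum : p ≠ ∞ → ∑ i ∈ s, d i ^ p.toReal ≤ c ^ p.toReal) :
    ∑ i ∈ s, h i ^ β * d i ^ a ≤
      l ^ (β - m * (1 - a * (1 / p).toReal)) * S ^ (1 - a * (1 / p).toReal) * c ^ a := by
  have hθ0 : 0 ≤ (1 / p).toReal := ENNReal.toReal_nonneg
  have hθ1 : (1 / p).toReal ≤ 1 := by
    rw [one_div]
    simpa using ENNReal.toReal_mono ENNReal.one_ne_top (ENNReal.inv_le_one.2 hp)
  have haθ : a * (1 / p).toReal ≤ 1 := mul_le_one₀ ha' hθ0 hθ1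
  have hmθ : 0 ≤ m * (1 - a * (1 / p).toReal) := mul_nonneg hm.le (by linarith)
  have hS0 : 0 ≤ ∑ i ∈ s, h i ^ m := Finset.sum_nonneg fun i hi => Real.rpow_nonneg (hh i hi) m
  have hmain : ∑ i ∈ s, (h i ^ m) ^ (1 - a * (1 / p).toReal) * d i ^ a ≤
      S ^ (1 - a * (1 / p).toReal) * c ^ a := by
    by_cases hpt : p = ∞
    · have hθ : (1 / p).toReal = 0 := by simp [hpt]
      rw [hθ, mul_zero, sub_zero, Real.rpow_one]
      calc ∑ i ∈ s, (h i ^ m) ^ (1 : ℝ) * d i ^ a ≤ ∑ i ∈ s, h i ^ m * c ^ a := by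
            refine Finset.sum_le_sum fun i hi => ?_
            rw [Real.rpow_one]
            exact mul_le_mul_of_nonneg_left (Real.rpow_le_rpow (hd i hi) (hsup hpt i hi) ha)
              (Real.rpow_nonneg (hh i hi) m)
        _ = (∑ i ∈ s, h i ^ m) * c ^ a := (Finset.sum_mul _ _ _).symm
        _ ≤ S * c ^ a := mul_le_mul_of_nonneg_right hS (Real.rpow_nonneg hc a)
    · have hp0 : 0 < p.toReal := ENNReal.toReal_pos (by positivity) hpt
      have hθ : p.toReal * (a * (1 / p).toReal) = a := by
        rw [one_div, ENNReal.toReal_inv]; field_simp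
      calc ∑ i ∈ s, (h i ^ m) ^ (1 - a * (1 / p).toReal) * d i ^ a
          = ∑ i ∈ s, (h i ^ m) ^ (1 - a * (1 / p).toReal) *
              (d i ^ p.toReal) ^ (a * (1 / p).toReal) := by
            refine Finset.sum_congr rfl fun i hi => ?_
            rw [← Real.rpow_mul (hd i hi), hθ]
        _ ≤ (∑ i ∈ s, h i ^ m) ^ (1 - a * (1 / p).toReal) *
              (∑ i ∈ s, d i ^ p.toReal) ^ (a * (1 / p).toReal) :=
            sum_rpow_mul_rpow_le s (by positivity) haθ
              (fun i hi => Real.rpow_nonneg (hh i hi) m) fun i hi => Real.rpow_nonneg (hd i hi) _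
        _ ≤ S ^ (1 - a * (1 / p).toReal) * (c ^ p.toReal) ^ (a * (1 / p).toReal) := by
            have := Finset.sum_nonneg fun i hi => Real.rpow_nonneg (hd i hi) p.toReal
            have h1 := hsum hpt
            have h2 : 0 ≤ 1 - a * (1 / p).toReal := by linarith
            have h3 : 0 ≤ S := hS0.trans hS
            gcongr
        _ = S ^ (1 - a * (1 / p).toReal) * c ^ a := by rw [← Real.rpow_mul hc, hθ]
  calc ∑ i ∈ s, h i ^ β * d i ^ a
      ≤ ∑ i ∈ s, l ^ (β - m * (1 - a * (1 / p).toReal)) *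
          ((h i ^ m) ^ (1 - a * (1 / p).toReal) * d i ^ a) := by
        refine Finset.sum_le_sum fun i hi => ?_
        rw [← mul_assoc]
        refine mul_le_mul_of_nonneg_right ?_ (Real.rpow_nonneg (hd i hi) a)
        rw [← Real.rpow_mul (hh i hi)]
        calc h i ^ β = h i ^ (β - m * (1 - a * (1 / p).toReal)) *
              h i ^ (m * (1 - a * (1 / p).toReal)) := by
              rw [← Real.rpow_add_of_nonneg (hh i hi) (by linarith) hmθ, sub_add_cancel]
          _ ≤ _ := mul_le_mul_of_nonneg_right
              (Real.rpow_le_rpow (hh i hi) (hhl i hi) (by linarith))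
              (Real.rpow_nonneg (hh i hi) _)
    _ = l ^ (β - m * (1 - a * (1 / p).toReal)) *
          ∑ i ∈ s, (h i ^ m) ^ (1 - a * (1 / p).toReal) * d i ^ a := (Finset.mul_sum _ _ _).symm
    _ ≤ _ := by
        rw [mul_assoc]
        exact mul_le_mul_of_nonneg_left hmain (Real.rpow_nonneg hl _)

/-! ### Weight functions -/

section Weight

variable {v : ℝ → ℝ} {A α : ℝ}

/-- The growth bound `v u ≤ (A / α) * u ^ α`: the right-hand side vanishes at `0`, like `v`, and its
derivative bounds that of `v`. -/
theorem weight_le (hα : 1 ≤ α) (hv : DifferentiableOn ℝ v (Set.Ici 0)) (hv0 : v 0 = 0)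
    (hd : ∀ u, 0 ≤ u → |derivWithin v (Set.Ici 0) u| ≤ A * u ^ (α - 1)) {u : ℝ} (hu : 0 ≤ u) :
    v u ≤ A / α * u ^ α := by
  have hB : ∀ x : ℝ, HasDerivAt (fun x : ℝ => A / α * x ^ α) (A * x ^ (α - 1)) x := by
    intro x
    have h := (Real.hasDerivAt_rpow_const (x := x) (Or.inr hα)).const_mul (A / α)
    have e : A / α * (α * x ^ (α - 1)) = A * x ^ (α - 1) := by
      have : α ≠ 0 := by linarith
      field_simp
    rwa [e] at h
  refine image_le_of_deriv_right_le_deriv_boundary (a := 0) (b := u)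
    (f' := derivWithin v (Set.Ici 0)) (hv.continuousOn.mono Set.Icc_subset_Ici_self) ?_ ?_
    (fun x _ => (hB x).continuousAt.continuousWithinAt)
    (fun x _ => (hB x).hasDerivWithinAt) (fun x hx => (le_abs_self _).trans (hd x hx.1)) ⟨hu, le_rfl⟩
  · exact fun x hx => ((hv x hx.1).hasDerivWithinAt).mono (Set.Ici_subset_Ici.2 hx.1)
  · rw [hv0, Real.zero_rpow (by linarith), mul_zero]

/-- The mean value inequality for weights, with the increment `|x - y|` split as
`|x - y| ^ (1 - a) * |x - y| ^ a` and the first factor bounded by the larger argument. -/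
theorem abs_weight_sub_le (hα : 1 ≤ α) (hA : 0 ≤ A) (hv : DifferentiableOn ℝ v (Set.Ici 0))
    (hd : ∀ u, 0 ≤ u → |derivWithin v (Set.Ici 0) u| ≤ A * u ^ (α - 1)) {a : ℝ} (ha : 0 ≤ a)
    (ha' : a ≤ 1) {x y : ℝ} (hx : 0 ≤ x) (hy : 0 ≤ y) :
    |v x - v y| ≤ A * max x y ^ (α - a) * |x - y| ^ a := by
  have hM : 0 ≤ max x y := le_max_of_le_left hx
  have h1 : ‖v x - v y‖ ≤ A * max x y ^ (α - 1) * ‖x - y‖ := by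
    refine Convex.norm_image_sub_le_of_norm_hasDerivWithin_le (s := Set.Icc 0 (max x y))
      (f' := derivWithin v (Set.Ici 0)) (fun u hu => ?_) (fun u hu => ?_) (convex_Icc _ _)
      ⟨hy, le_max_right _ _⟩ ⟨hx, le_max_left _ _⟩
    · exact ((hv u hu.1).hasDerivWithinAt).mono Set.Icc_subset_Ici_self
    · refine (hd u hu.1).trans (mul_le_mul_of_nonneg_left ?_ hA)
      exact Real.rpow_le_rpow hu.1 hu.2 (by linarith)
  have h2 : |x - y| ≤ max x y := by
    rw [abs_le]
    constructor
    · linarith [le_max_right x y]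
    · linarith [le_max_left x y]
  calc |v x - v y| ≤ A * max x y ^ (α - 1) * |x - y| := h1
    _ = A * max x y ^ (α - 1) * (|x - y| ^ (1 - a) * |x - y| ^ a) := by
        rw [← Real.rpow_add_of_nonneg (abs_nonneg _) (by linarith) ha, sub_add_cancel,
          Real.rpow_one]
    _ ≤ A * max x y ^ (α - 1) * (max x y ^ (1 - a) * |x - y| ^ a) := by
        have := Real.rpow_le_rpow (abs_nonneg _) h2 (by linarith : 0 ≤ 1 - a)
        gcongr
    _ = A * max x y ^ (α - a) * |x - y| ^ a := by
        rw [mul_assoc, mul_assoc, ← mul_assoc (max x y ^ (α - 1)),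
          ← Real.rpow_add_of_nonneg hM (by linarith) (by linarith), sub_add_sub_cancel]

end Weight

/-! ### Sums over matched points -/

namespace Augmented

/-- The persistence `r₂ - r₁` of a point of `D ∪ Δ`; it vanishes on the diagonal. -/
noncomputable def persistence {D : Diagram} (x : Augmented D) : ℝ := x.point 1 - x.point 0

/-- The value of `φ` at a point of `D ∪ Δ`, extended by zero to the diagonal. The extension is
not continuous; its values on the diagonal are only ever multiplied by the weight zero. -/
noncomputable def value {B : Type*} [Zero B] (φ : HalfPlane → B) {D : Diagram} : Augmented D → B
  | Sum.inl x => φ x.1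
  | Sum.inr _ => 0

@[simp]
theorem persistence_inl {D : Diagram} (x) :
    persistence (Sum.inl x : Augmented D) = pers x.1 := rfl

@[simp]
theorem persistence_inr {D : Diagram} (x) : persistence (Sum.inr x : Augmented D) = 0 :=
  sub_eq_zero.2 x.1.2.symm

theorem persistence_nonneg {D : Diagram} (x : Augmented D) : 0 ≤ x.persistence := by
  rcases x with x | x
  · exact (pers_pos _).le
  · simp

theorem persistence_le {D : Diagram} {l : ℝ} (hl : 0 ≤ l) (h : ∀ r ∈ D, pers r ≤ l)
    (x : Augmented D) : x.persistence ≤ l := by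
  classical
  rcases x with x | x
  · exact h _ (Multiset.coe_mem)
  · simpa using hl

theorem abs_persistence_sub_le {D D' : Diagram} (x : Augmented D) (y : Augmented D') :
    |x.persistence - y.persistence| ≤ √2 * dist x.point y.point := by
  rw [EuclideanSpace.dist_eq, ← Real.sqrt_mul (by norm_num), Fin.sum_univ_two]
  refine Real.abs_le_sqrt ?_
  simp only [Real.dist_eq, sq_abs, persistence]
  nlinarith [sq_nonneg (x.point 0 - y.point 0 + (x.point 1 - y.point 1))]

/-- The finite set of the points of `D` in `D ∪ Δ`. -/
noncomputable def offDiagonal (D : Diagram) : Finset (Augmented D) :=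
  Finset.univ.map Function.Embedding.inl

theorem sum_offDiagonal {M : Type*} [AddCommMonoid M] {D : Diagram} (G : Augmented D → M)
    (g : HalfPlane → M) (h : ∀ x, G (Sum.inl x) = g x.1) :
    ∑ x ∈ offDiagonal D, G x = (D.map g).sum := by
  classical
  rw [offDiagonal, Finset.sum_map]
  simp only [Function.Embedding.inl_apply, h]
  rw [Finset.sum, Multiset.map_univ]

theorem eq_inr_of_notMem_offDiagonal {D : Diagram} {x : Augmented D} (hx : x ∉ offDiagonal D) :
    ∃ y, x = Sum.inr y := by
  rcases x with x | y
  · exact absurd (Finset.mem_map_of_mem _ (Finset.mem_univ x)) hx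
  · exact ⟨y, rfl⟩

open Classical in
/-- The finite set of the pairs of a matching that are not pairs of two diagonal points. -/
noncomputable def matchedSupport {D D' : Diagram} (γ : Augmented D ≃ Augmented D') : Finset (Augmented D) :=
  offDiagonal D ∪ (offDiagonal D').map γ.symm.toEmbedding

theorem sum_matchedSupport {M : Type*} [AddCommMonoid M] {D D' : Diagram}
    (γ : Augmented D ≃ Augmented D') (G : Augmented D → M) (hG : ∀ y, G (Sum.inr y) = 0)
    (g : HalfPlane → M) (h : ∀ x, G (Sum.inl x) = g x.1) :
    ∑ x ∈ matchedSupport γ, G x = (D.map g).sum := by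
  classical
  rw [← sum_offDiagonal G g h]
  refine (Finset.sum_subset Finset.subset_union_left fun x _ hx => ?_).symm
  obtain ⟨y, rfl⟩ := eq_inr_of_notMem_offDiagonal hx
  exact hG y

theorem sum_matchedSupport_apply {M : Type*} [AddCommMonoid M] {D D' : Diagram}
    (γ : Augmented D ≃ Augmented D') (G : Augmented D' → M) (hG : ∀ y, G (Sum.inr y) = 0)
    (g : HalfPlane → M) (h : ∀ x, G (Sum.inl x) = g x.1) :
    ∑ x ∈ matchedSupport γ, G (γ x) = (D'.map g).sum := by
  classical
  rw [← sum_offDiagonal G g h]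
  trans ∑ x ∈ (offDiagonal D').map γ.symm.toEmbedding, G (γ x)
  · refine (Finset.sum_subset Finset.subset_union_right fun x _ hx => ?_).symm
    have hx' : γ x ∉ offDiagonal D' := fun h' =>
      hx (Finset.mem_map.2 ⟨γ x, h', γ.symm_apply_apply x⟩)
    obtain ⟨y, hy⟩ := eq_inr_of_notMem_offDiagonal hx'
    rw [hy, hG]
  · simp

end Augmented

open Augmented

theorem dist_le_matchingCost_top {D D' : Diagram} {γ : Augmented D ≃ Augmented D'}
    (hγ : matchingCost ∞ γ ≠ ∞) (x : Augmented D) :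
    dist x.point (γ x).point ≤ (matchingCost ∞ γ).toReal := by
  rw [dist_edist]
  refine ENNReal.toReal_mono hγ ?_
  rw [matchingCost, if_pos rfl]
  exact le_iSup (fun x : Augmented D => edist x.point (γ x).point) x

theorem sum_dist_rpow_le_matchingCost {p : ℝ≥0∞} (hp : 1 ≤ p) (hpt : p ≠ ∞) {D D' : Diagram}
    {γ : Augmented D ≃ Augmented D'} (hγ : matchingCost p γ ≠ ∞) (s : Finset (Augmented D)) :
    ∑ x ∈ s, dist x.point (γ x).point ^ p.toReal ≤ (matchingCost p γ).toReal ^ p.toReal := by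
  have hp0 : 0 < p.toReal := ENNReal.toReal_pos (by positivity) hpt
  have h : ∑ x ∈ s, edist x.point (γ x).point ^ p.toReal ≤ matchingCost p γ ^ p.toReal := by
    rw [matchingCost, if_neg hpt, one_div, ENNReal.rpow_inv_rpow hp0.ne']
    exact ENNReal.sum_le_tsum s
  have h' := ENNReal.toReal_mono (ENNReal.rpow_ne_top_of_nonneg hp0.le hγ) h
  rw [ENNReal.toReal_sum fun x _ => ENNReal.rpow_ne_top_of_nonneg hp0.le (edist_ne_top _ _)] at h'
  simpa only [← ENNReal.toReal_rpow, ← dist_edist] using h'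

section Matching

variable {B : Type*} [NormedAddCommGroup B] [NormedSpace ℝ B]
  {w : HalfPlane → ℝ} {φ : HalfPlane → B} {A α : ℝ}

/-- The contribution of one matched pair. The difference `v x φ x - v y φ y` is split as
`v x (φ x - φ y) + (v x - v y) φ y`; if one of the points lies on the diagonal, only one weight is
left and no continuity of `φ` is needed. -/
theorem norm_smul_value_sub_le {v : ℝ → ℝ} (hα : 1 ≤ α) (hA : 0 ≤ A)
    (hv : DifferentiableOn ℝ v (Set.Ici 0)) (hvn : ∀ u, 0 ≤ u → 0 ≤ v u) (hv0 : v 0 = 0)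
    (hd : ∀ u, 0 ≤ u → |derivWithin v (Set.Ici 0) u| ≤ A * u ^ (α - 1))
    (hφ : ∃ K : ℝ≥0, LipschitzWith K φ) (hφb : ∃ M : ℝ, ∀ r, ‖φ r‖ ≤ M)
    {a : ℝ} (ha : 0 ≤ a) (ha' : a ≤ 1) {D D' : Diagram} (x : Augmented D) (y : Augmented D') :
    ‖v x.persistence • value φ x - v y.persistence • value φ y‖ ≤
      lipConst φ * (A / α) * (x.persistence ^ α * dist x.point y.point ^ (1 : ℝ)) +
      2 ^ (a / 2) * supNorm φ * A *
        (max x.persistence y.persistence ^ (α - a) * dist x.point y.point ^ a) := by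
  have hsup := supNorm_nonneg φ
  have hlip := lipConst_nonneg φ
  have hx := x.persistence_nonneg
  have hα0 : 0 < α := by linarith
  have hM : 0 ≤ max x.persistence y.persistence := le_max_of_le_left hx
  have hfirst : 0 ≤ lipConst φ * (A / α) *
      (x.persistence ^ α * dist x.point y.point ^ (1 : ℝ)) := by positivity
  have hsecond : |v x.persistence - v y.persistence| * supNorm φ ≤ 2 ^ (a / 2) * supNorm φ * A *
        (max x.persistence y.persistence ^ (α - a) * dist x.point y.point ^ a) := by
    have h1 := abs_weight_sub_le hα hA hv hd ha ha' hx y.persistence_nonneg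
    have h2 : |x.persistence - y.persistence| ^ a ≤ 2 ^ (a / 2) * dist x.point y.point ^ a := by
      refine (Real.rpow_le_rpow (abs_nonneg _) (abs_persistence_sub_le x y) ha).trans_eq ?_
      rw [Real.mul_rpow (Real.sqrt_nonneg 2) dist_nonneg, Real.sqrt_eq_rpow,
        ← Real.rpow_mul (by norm_num), one_div_mul_eq_div]
    calc |v x.persistence - v y.persistence| * supNorm φ
        ≤ A * max x.persistence y.persistence ^ (α - a) *
            |x.persistence - y.persistence| ^ a * supNorm φ := by gcongr
      _ ≤ A * max x.persistence y.persistence ^ (α - a) *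
            (2 ^ (a / 2) * dist x.point y.point ^ a) * supNorm φ := by gcongr
      _ = _ := by ring
  rcases x with x | x <;> rcases y with y | y
  · refine le_trans ?_ (add_le_add (le_refl _) hsecond)
    simp only [persistence_inl, value]
    have e : v (pers x.1) • φ x.1 - v (pers y.1) • φ y.1 =
        v (pers x.1) • (φ x.1 - φ y.1) + (v (pers x.1) - v (pers y.1)) • φ y.1 := by
      rw [smul_sub, sub_smul]; abel
    rw [e]
    refine (norm_add_le _ _).trans (add_le_add ?_ ?_)
    · have h1 : ‖φ x.1 - φ y.1‖ ≤ lipConst φ * dist x.1.1 y.1.1 := by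
        rw [← dist_eq_norm]
        exact (lipschitzWith_sInf hφ).dist_le_mul _ _
      have h2 := weight_le hα hv hv0 hd (pers_pos x.1).le
      rw [norm_smul, Real.norm_of_nonneg (hvn _ (pers_pos x.1).le), Real.rpow_one]
      calc v (pers x.1) * ‖φ x.1 - φ y.1‖
          ≤ A / α * pers x.1 ^ α * (lipConst φ * dist x.1.1 y.1.1) := by
            gcongr
        _ = _ := by simp only [Augmented.point]; ring
    · rw [norm_smul, Real.norm_eq_abs]
      exact mul_le_mul_of_nonneg_left (norm_le_supNorm hφb _) (abs_nonneg _)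
  · refine le_trans ?_ (hsecond.trans (le_add_of_nonneg_left hfirst))
    simp only [persistence_inl, persistence_inr, value, hv0, smul_zero, sub_zero, norm_smul,
      Real.norm_eq_abs]
    exact mul_le_mul_of_nonneg_left (norm_le_supNorm hφb _) (abs_nonneg _)
  · refine le_trans ?_ (hsecond.trans (le_add_of_nonneg_left hfirst))
    simp only [persistence_inl, persistence_inr, value, hv0, smul_zero, zero_sub, norm_neg,
      norm_smul, Real.norm_eq_abs, abs_neg]
    exact mul_le_mul_of_nonneg_left (norm_le_supNorm hφb _) (abs_nonneg _)
  · refine le_trans ?_ (hsecond.trans (le_add_of_nonneg_left hfirst))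
    simp only [persistence_inr, value, smul_zero, sub_zero, norm_zero]
    positivity

/-- The stability estimate for a single matching `γ` of finite cost: sum the contributions of all
pairs, and apply Hölder's inequality with displacement exponents `1` and `a`. -/
theorem norm_representation_sub_le_of_matching (hw : w ∈ weightClass α A) (hα : 1 ≤ α)
    (hA : 0 ≤ A) (hφ : ∃ K : ℝ≥0, LipschitzWith K φ) (hφb : ∃ M : ℝ, ∀ r, ‖φ r‖ ≤ M)
    {p : ℝ≥0∞} (hp : 1 ≤ p) {m a l S : ℝ} (hm : 0 < m) (hmp : m * (1 / p).toReal ≤ 1)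
    (ha : 0 ≤ a) (ha' : a ≤ 1) (hmα : m + a * (1 - m * (1 / p).toReal) ≤ α) (hl : 0 ≤ l)
    {D D' : Diagram} (hlD : ∀ r ∈ D, pers r ≤ l) (hlD' : ∀ r ∈ D', pers r ≤ l)
    (hD : totalPers m D ≤ S) (hD' : totalPers m D' ≤ S) (γ : Augmented D ≃ Augmented D')
    (hγ : matchingCost p γ ≠ ∞) :
    ‖representation w φ D - representation w φ D'‖ ≤
      lipConst φ * (A / α) * l ^ (α - m * (1 - (1 / p).toReal)) * S ^ (1 - (1 / p).toReal) *
          (matchingCost p γ).toReal +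
        2 ^ (a / 2) * supNorm φ * A * l ^ (α - m - a * (1 - m * (1 / p).toReal)) *
          (2 * S) ^ (1 - a * (1 / p).toReal) * (matchingCost p γ).toReal ^ a := by
  obtain ⟨v, hv, hvn, hv0, hd, hwv⟩ := hw
  have hα0 : 0 < α := by linarith
  have hsup := supNorm_nonneg φ
  have hlip := lipConst_nonneg φ
  have hθ0 : 0 ≤ (1 / p).toReal := ENNReal.toReal_nonneg
  have hrep : representation w φ D =
      ∑ x ∈ matchedSupport γ, v x.persistence • value φ x :=
    (sum_matchedSupport γ _ (by simp [hv0]) _ fun x => by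
      simp only [persistence_inl, value, hwv]).symm
  have hrep' : representation w φ D' =
      ∑ x ∈ matchedSupport γ, v (γ x).persistence • value φ (γ x) :=
    (sum_matchedSupport_apply γ (fun y => v y.persistence • value φ y) (by simp [hv0]) _ fun x => by
      simp only [persistence_inl, value, hwv]).symm
  have hpersD : ∑ x ∈ matchedSupport γ, x.persistence ^ m = totalPers m D :=
    sum_matchedSupport γ _ (by simp [Real.zero_rpow hm.ne']) _ fun x => rfl
  have hpersD' : ∑ x ∈ matchedSupport γ, (γ x).persistence ^ m = totalPers m D' :=
    sum_matchedSupport_apply γ (fun y => y.persistence ^ m) (by simp [Real.zero_rpow hm.ne']) _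
      fun x => rfl
  have hmax : ∑ x ∈ matchedSupport γ, max x.persistence (γ x).persistence ^ m ≤ 2 * S := by
    have : ∀ x ∈ matchedSupport γ, max x.persistence (γ x).persistence ^ m ≤
        x.persistence ^ m + (γ x).persistence ^ m := by
      intro x _
      have h1 := Real.rpow_nonneg x.persistence_nonneg m
      have h2 := Real.rpow_nonneg (γ x).persistence_nonneg m
      rcases max_choice x.persistence (γ x).persistence with h | h <;> rw [h] <;> linarith
    refine (Finset.sum_le_sum this).trans ?_
    rw [Finset.sum_add_distrib, hpersD, hpersD']
    linarith
  have hcostsup : p = ∞ → ∀ x ∈ matchedSupport γ,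
      dist x.point (γ x).point ≤ (matchingCost p γ).toReal := by
    rintro rfl x -
    exact dist_le_matchingCost_top hγ x
  have hcostsum := fun hpt : p ≠ ∞ => sum_dist_rpow_le_matchingCost hp hpt hγ (matchedSupport γ)
  have hH1 := sum_rpow_mul_rpow_le_of_cost (matchedSupport γ) hp (m := m) (β := α) (a := 1) hm
    zero_le_one le_rfl hl ENNReal.toReal_nonneg (by nlinarith)
    (fun x _ => x.persistence_nonneg) (fun x _ => x.persistence_le hl hlD)
    (fun x _ => dist_nonneg) (hpersD.trans_le hD) hcostsup hcostsum
  have hH2 := sum_rpow_mul_rpow_le_of_cost (matchedSupport γ) hp (m := m) (β := α - a) (a := a) hm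
    ha ha' hl ENNReal.toReal_nonneg (by linarith)
    (fun x _ => le_max_of_le_left x.persistence_nonneg)
    (fun x _ => max_le (x.persistence_le hl hlD) ((γ x).persistence_le hl hlD'))
    (fun x _ => dist_nonneg) hmax hcostsup hcostsum
  rw [one_mul, Real.rpow_one] at hH1
  rw [show α - a - m * (1 - a * (1 / p).toReal) = α - m - a * (1 - m * (1 / p).toReal) by ring]
    at hH2
  rw [hrep, hrep', ← Finset.sum_sub_distrib]
  calc ‖∑ x ∈ matchedSupport γ,
        (v x.persistence • value φ x - v (γ x).persistence • value φ (γ x))‖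
      ≤ ∑ x ∈ matchedSupport γ,
        (lipConst φ * (A / α) * (x.persistence ^ α * dist x.point (γ x).point ^ (1 : ℝ)) +
        2 ^ (a / 2) * supNorm φ * A *
        (max x.persistence (γ x).persistence ^ (α - a) * dist x.point (γ x).point ^ a)) :=
        norm_sum_le_of_le _ fun x _ =>
          norm_smul_value_sub_le hα hA hv hvn hv0 hd hφ hφb ha ha' x (γ x)
    _ = lipConst φ * (A / α) *
          ∑ x ∈ matchedSupport γ, x.persistence ^ α * dist x.point (γ x).point ^ (1 : ℝ) +
        2 ^ (a / 2) * supNorm φ * A * ∑ x ∈ matchedSupport γ,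
          max x.persistence (γ x).persistence ^ (α - a) * dist x.point (γ x).point ^ a := by
        rw [Finset.sum_add_distrib, Finset.mul_sum, Finset.mul_sum]
    _ ≤ lipConst φ * (A / α) * (l ^ (α - m * (1 - (1 / p).toReal)) * S ^ (1 - (1 / p).toReal) *
          (matchingCost p γ).toReal) +
        2 ^ (a / 2) * supNorm φ * A * (l ^ (α - m - a * (1 - m * (1 / p).toReal)) *
          (2 * S) ^ (1 - a * (1 / p).toReal) * (matchingCost p γ).toReal ^ a) := by gcongr
    _ = _ := by ring

end Matching

/-! ### Finiteness of the Wasserstein distance -/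

/-- The orthogonal projection of the plane to the diagonal. -/
noncomputable def diagonalProj (r : Plane) : Diagonal := ⟨!₂[(r 0 + r 1) / 2, (r 0 + r 1) / 2], by simp⟩

theorem diagonalProj_coe (r : Diagonal) : diagonalProj r.1 = r := by
  refine Subtype.ext ?_
  ext i
  have := r.2
  fin_cases i <;> simp [diagonalProj] <;> linarith

/-- Every point of the diagonal is the projection of countably infinitely many points of `D ∪ Δ`,
so that `D ∪ Δ` can be matched with `Δ` along the projection. -/
theorem exists_equiv_diagonal (D : Diagram) :
    ∃ e : Augmented D ≃ Diagonal × ℕ, ∀ x, (e x).1 = diagonalProj x.point := by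
  have hfib : ∀ r : Diagonal,
      Nonempty ({x : Augmented D // diagonalProj x.point = r} ≃ ℕ) := by
    intro r
    have hinj : Function.Injective
        (fun n : ℕ => (⟨Sum.inr (r, n), diagonalProj_coe r⟩ :
          {x : Augmented D // diagonalProj x.point = r})) := fun n n' h =>
      (Prod.ext_iff.1 (Sum.inr.inj (Subtype.ext_iff.1 h))).2
    have : Infinite {x : Augmented D // diagonalProj x.point = r} := Infinite.of_injective _ hinj
    have : Countable {x : Augmented D // diagonalProj x.point = r} := by
      refine Function.Injective.countable (β := D.ToType ⊕ ℕ)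
        (f := fun x => x.1.map id Prod.snd) ?_
      rintro ⟨x | ⟨d, n⟩, hx⟩ ⟨y | ⟨d', n'⟩, hy⟩ h
      · simpa using h
      · simp at h
      · simp at h
      · have h1 : d = r := (diagonalProj_coe d).symm.trans hx
        have h2 : d' = r := (diagonalProj_coe d').symm.trans hy
        simp_all
    exact nonempty_equiv_of_countable
  exact ⟨(Equiv.sigmaFiberEquiv fun x : Augmented D => diagonalProj x.point).symm.trans
    ((Equiv.sigmaCongrRight fun r => (hfib r).some).trans (Equiv.sigmaEquivProd _ _)),
    fun x => rfl⟩

/-- Matching both diagrams with the diagonal gives a finite cost, because only finitely many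
displacements are nonzero. -/
theorem exists_matchingCost_ne_top {p : ℝ≥0∞} (hp : 1 ≤ p) (D D' : Diagram) :
    ∃ γ : Augmented D ≃ Augmented D', matchingCost p γ ≠ ∞ := by
  obtain ⟨e, he⟩ := exists_equiv_diagonal D
  obtain ⟨e', he'⟩ := exists_equiv_diagonal D'
  refine ⟨e.trans e'.symm, ?_⟩
  set γ := e.trans e'.symm with hγ
  have hproj : ∀ x, diagonalProj (γ x).point = diagonalProj x.point := fun x => by
    rw [← he', ← he, hγ, Equiv.trans_apply, Equiv.apply_symm_apply]
  have hzero : ∀ x ∉ matchedSupport γ, edist x.point (γ x).point = 0 := by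
    classical
    intro x hx
    rw [matchedSupport, Finset.mem_union, not_or] at hx
    obtain ⟨y, rfl⟩ := eq_inr_of_notMem_offDiagonal hx.1
    have hx' : γ (Sum.inr y) ∉ offDiagonal D' := fun h' =>
      hx.2 (Finset.mem_map.2 ⟨_, h', γ.symm_apply_apply _⟩)
    obtain ⟨z, hz⟩ := eq_inr_of_notMem_offDiagonal hx'
    have h := hproj (Sum.inr y)
    rw [hz] at h ⊢
    have h' : z.1 = y.1 := by
      simpa only [Augmented.point, diagonalProj_coe] using h
    simp only [Augmented.point, h', edist_self]
  by_cases hpt : p = ∞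
  · rw [matchingCost, if_pos hpt]
    refine ne_top_of_le_ne_top (b := ∑ x ∈ matchedSupport γ, edist x.point (γ x).point)
      (ENNReal.sum_ne_top.2 fun x _ => edist_ne_top _ _) (iSup_le fun x => ?_)
    by_cases hx : x ∈ matchedSupport γ
    · exact Finset.single_le_sum (f := fun x : Augmented D => edist x.point (γ x).point)
        (fun _ _ => zero_le) hx
    · simp [hzero x hx]
  · have hp0 : 0 < p.toReal := ENNReal.toReal_pos (by positivity) hpt
    rw [matchingCost, if_neg hpt, tsum_eq_sum fun x hx => by
      rw [hzero x hx, ENNReal.zero_rpow_of_pos hp0]]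
    refine ENNReal.rpow_ne_top_of_nonneg (by positivity) (ENNReal.sum_ne_top.2 fun x _ => ?_)
    exact ENNReal.rpow_ne_top_of_nonneg hp0.le (edist_ne_top _ _)

/-- A bound that is a continuous function of the cost of a matching passes to the infimum, i.e. to
the Wasserstein distance. -/
theorem le_of_forall_matchingCost {p : ℝ≥0∞} (hp : 1 ≤ p) {D D' : Diagram} {N : ℝ} {F : ℝ → ℝ}
    (hF : Continuous F) (hmono : MonotoneOn F (Set.Ici 0))
    (h : ∀ γ : Augmented D ≃ Augmented D', matchingCost p γ ≠ ∞ →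
      N ≤ F (matchingCost p γ).toReal) :
    N ≤ F (wassersteinDist p D D') := by
  obtain ⟨γ₀, hγ₀⟩ := exists_matchingCost_ne_top hp D D'
  have hfin : (⨅ γ : Augmented D ≃ Augmented D', matchingCost p γ) ≠ ∞ :=
    ne_top_of_le_ne_top hγ₀ (iInf_le _ γ₀)
  refine ge_of_tendsto (hF.continuousAt.mono_left nhdsWithin_le_nhds)
    (Filter.eventually_of_mem (self_mem_nhdsWithin (s := Set.Ioi (wassersteinDist p D D')))
      fun c hc => ?_)
  have hc0 : 0 ≤ c := ENNReal.toReal_nonneg.trans (le_of_lt hc)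
  obtain ⟨γ, hγ⟩ := iInf_lt_iff.1 ((ENNReal.lt_ofReal_iff_toReal_lt hfin).2 hc)
  have hγt : matchingCost p γ ≠ ∞ := hγ.ne_top
  exact (h γ hγt).trans (hmono ENNReal.toReal_nonneg hc0
    ((ENNReal.lt_ofReal_iff_toReal_lt hγt).1 hγ).le)

/-! ### Stability of linear representations -/

section Stability

variable {B : Type*} [NormedAddCommGroup B] [NormedSpace ℝ B]
  {w : HalfPlane → ℝ} {φ : HalfPlane → B} {A α : ℝ}

/-- The stability estimate for two diagrams whose points have persistence at most `l` and whose
total persistence of degree `m` is at most `S`. -/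
theorem norm_representation_sub_le (hw : w ∈ weightClass α A) (hα : 1 ≤ α)
    (hA : 0 ≤ A) (hφ : ∃ K : ℝ≥0, LipschitzWith K φ) (hφb : ∃ M : ℝ, ∀ r, ‖φ r‖ ≤ M)
    {p : ℝ≥0∞} (hp : 1 ≤ p) {m a l S : ℝ} (hm : 0 < m) (hmp : m * (1 / p).toReal ≤ 1)
    (ha : 0 ≤ a) (ha' : a ≤ 1) (hmα : m + a * (1 - m * (1 / p).toReal) ≤ α) (hl : 0 ≤ l)
    {D D' : Diagram} (hlD : ∀ r ∈ D, pers r ≤ l) (hlD' : ∀ r ∈ D', pers r ≤ l)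
    (hD : totalPers m D ≤ S) (hD' : totalPers m D' ≤ S) :
    ‖representation w φ D - representation w φ D'‖ ≤
      lipConst φ * (A / α) * l ^ (α - m * (1 - (1 / p).toReal)) * S ^ (1 - (1 / p).toReal) *
          wassersteinDist p D D' +
        2 ^ (a / 2) * supNorm φ * A * l ^ (α - m - a * (1 - m * (1 / p).toReal)) *
          (2 * S) ^ (1 - a * (1 / p).toReal) * wassersteinDist p D D' ^ a := by
  have hS : 0 ≤ S := (totalPers_nonneg m D).trans hD
  have hα0 : 0 < α := by linarith
  have hsup := supNorm_nonneg φ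
  have hlip := lipConst_nonneg φ
  refine le_of_forall_matchingCost hp
    (F := fun c => lipConst φ * (A / α) * l ^ (α - m * (1 - (1 / p).toReal)) *
        S ^ (1 - (1 / p).toReal) * c +
      2 ^ (a / 2) * supNorm φ * A * l ^ (α - m - a * (1 - m * (1 / p).toReal)) *
        (2 * S) ^ (1 - a * (1 / p).toReal) * c ^ a) ?_ ?_
    (norm_representation_sub_le_of_matching hw hα hA hφ hφb hp hm hmp ha ha' hmα hl hlD hlD' hD hD')
  · exact (continuous_const.mul continuous_id).add
      (continuous_const.mul (Real.continuous_rpow_const ha))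
  · intro c hc c' _ hcc
    have : (0 : ℝ) ≤ c := hc
    dsimp only
    gcongr

theorem norm_representation_le (hw : w ∈ weightClass α A) (hα : 1 ≤ α) (hA : 0 ≤ A)
    (hφb : ∃ M : ℝ, ∀ r, ‖φ r‖ ≤ M) {m l S : ℝ} (hm : 0 ≤ m) (hmα : m ≤ α) {D : Diagram}
    (hlD : ∀ r ∈ D, pers r ≤ l) (hD : totalPers m D ≤ S) (hl : 0 ≤ l) :
    ‖representation w φ D‖ ≤ A / α * supNorm φ * l ^ (α - m) * S := by
  obtain ⟨v, hv, hvn, hv0, hd, hwv⟩ := hw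
  have hsup := supNorm_nonneg φ
  have hα0 : 0 < α := by linarith
  calc ‖representation w φ D‖ ≤ (D.map fun r => ‖w r • φ r‖).sum := by
        rw [representation]
        refine (norm_multiset_sum_le _).trans_eq ?_
        rw [Multiset.map_map]; rfl
    _ ≤ (D.map fun r => A / α * supNorm φ * l ^ (α - m) * pers r ^ m).sum := by
        refine Multiset.sum_map_le_sum_map _ _ fun r hr => ?_
        have hr0 := (pers_pos r).le
        rw [norm_smul, hwv, Real.norm_of_nonneg (hvn _ hr0)]
        calc v (pers r) * ‖φ r‖ ≤ A / α * pers r ^ α * supNorm φ :=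
              mul_le_mul (weight_le hα hv hv0 hd hr0) (norm_le_supNorm hφb r) (norm_nonneg _)
                (mul_nonneg (by positivity) (Real.rpow_nonneg hr0 _))
          _ = A / α * supNorm φ * (pers r ^ (α - m) * pers r ^ m) := by
              rw [← Real.rpow_add_of_nonneg hr0 (by linarith) hm, sub_add_cancel]; ring
          _ ≤ A / α * supNorm φ * (l ^ (α - m) * pers r ^ m) := by
              have h1 := Real.rpow_le_rpow hr0 (hlD r hr) (by linarith : 0 ≤ α - m)
              have h2 := Real.rpow_nonneg hr0 m
              gcongr
          _ = _ := by ring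
    _ = A / α * supNorm φ * l ^ (α - m) * totalPers m D := by
        rw [totalPers, Multiset.sum_map_mul_left]
    _ ≤ _ := by
        have := Real.rpow_nonneg hl (α - m)
        gcongr

end Stability

end Persistence

theorem corollary3p2 {X : Type*} [MetricSpace X] [CompactSpace X]
    (hX : Persistence.Triangulable X)
    {B : Type*} [NormedAddCommGroup B] [NormedSpace ℝ B] [CompleteSpace B]
    (m : ℝ) (hm : 1 ≤ m) (q₀ : ℕ) (C : ℝ)
    (hC : Persistence.BoundedTotalPersistence X m q₀ C)
    (q : ℕ) (hq : q₀ ≤ q)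
    (A α : ℝ) (hA : 0 < A) (hα : 1 ≤ α)
    (w : Persistence.HalfPlane → ℝ) (hw : w ∈ Persistence.weightClass α A)
    (φ : Persistence.HalfPlane → B) (hφ_lip : ∃ K : ℝ≥0, LipschitzWith K φ)
    (hφ_bdd : ∃ M : ℝ, ∀ r, ‖φ r‖ ≤ M)
    (p : ℝ≥0∞) (hp : ENNReal.ofReal m ≤ p) :
    (∀ a : ℝ, 0 ≤ a → a ≤ 1 → m + a * (1 - m * (1 / p).toReal) ≤ α →
      ∀ f g : X → ℝ, Persistence.Tame f → Persistence.Tame g →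
        (∃ K : ℝ≥0, LipschitzWith K f) → (∃ K : ℝ≥0, LipschitzWith K g) →
        ∀ C₀ l C₁ C₂ W : ℝ,
          C₀ = C * max (Persistence.lipConst f ^ m) (Persistence.lipConst g ^ m) →
          l = Persistence.maxPers (Persistence.dgm f q) (Persistence.dgm g q) →
          C₁ = Persistence.lipConst φ * (A / α) * l ^ (α - m * (1 - (1 / p).toReal))
            * C₀ ^ (1 - (1 / p).toReal) →
          C₂ = 2 ^ (a / 2) * Persistence.supNorm φ * A
            * l ^ (α - m - a * (1 - m * (1 / p).toReal))
            * (2 * C₀) ^ (1 - a * (1 / p).toReal) →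
          W = Persistence.wassersteinDist p (Persistence.dgm f q) (Persistence.dgm g q) →
          ‖Persistence.representation w φ (Persistence.dgm f q)
            - Persistence.representation w φ (Persistence.dgm g q)‖ ≤ C₁ * W + C₂ * W ^ a) ∧
    (m < α → ∀ L : ℝ≥0, ∃ K : ℝ, ∀ f g : X → ℝ, Persistence.Tame f → Persistence.Tame g →
      LipschitzWith L f → LipschitzWith L g →
        ‖Persistence.representation w φ (Persistence.dgm f q)
          - Persistence.representation w φ (Persistence.dgm g q)‖
          ≤ K * Persistence.wassersteinDist p (Persistence.dgm f q) (Persistence.dgm g q)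
            ^ min 1 (α - m)) := by
  open Persistence in
  have hm0 : 0 < m := by linarith
  have hp1 : 1 ≤ p := (ENNReal.one_le_ofReal.2 hm).trans hp
  have hmp : m * (1 / p).toReal ≤ 1 := by
    have h : (1 / p).toReal ≤ m⁻¹ := by
      rw [one_div]
      refine (ENNReal.toReal_mono ?_ (ENNReal.inv_le_inv.2 hp)).trans_eq ?_
      · simpa using hm0
      · rw [ENNReal.toReal_inv, ENNReal.toReal_ofReal hm0.le]
    calc m * (1 / p).toReal ≤ m * m⁻¹ := by gcongr
      _ = 1 := mul_inv_cancel₀ hm0.ne'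
  have hθ0 : 0 ≤ (1 / p).toReal := ENNReal.toReal_nonneg
  constructor
  · rintro a ha ha' hmα f g hf hg hfL hgL C₀ l C₁ C₂ W hC₀ rfl rfl rfl rfl
    have hTf := hC.totalPers_le hm0 hq hf (lipschitzWith_sInf hfL)
    have hTg := hC.totalPers_le hm0 hq hg (lipschitzWith_sInf hgL)
    -- The constant bounds the total persistence of a rescaling of `f`, so it is nonnegative.
    have hC0 : 0 ≤ C := by
      obtain ⟨K, hK⟩ := hfL
      have h1 := (totalPers_nonneg m _).trans
        (hC.totalPers_le hm0 hq hf (hK.weaken (le_add_of_nonneg_right zero_le_one)))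
      exact nonneg_of_mul_nonneg_left h1 (Real.rpow_pos_of_pos (by positivity) m)
    refine norm_representation_sub_le hw hα hA.le hφ_lip hφ_bdd hp1 hm0 hmp ha ha' hmα
      (maxPers_nonneg _ _) (fun r hr => pers_le_maxPers (Multiset.mem_add.2 (Or.inl hr)))
      (fun r hr => pers_le_maxPers (Multiset.mem_add.2 (Or.inr hr))) ?_ ?_
    · rw [hC₀]
      exact hTf.trans (mul_le_mul_of_nonneg_left (le_max_left _ _) hC0)
    · rw [hC₀]
      exact hTg.trans (mul_le_mul_of_nonneg_left (le_max_right _ _) hC0)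
  · intro hmα L
    have ha : 0 ≤ min 1 (α - m) := le_min zero_le_one (by linarith)
    generalize ha_def : min 1 (α - m) = a at ha ⊢
    have ha1 : a ≤ 1 := ha_def ▸ min_le_left _ _
    have haα : m + a * (1 - m * (1 / p).toReal) ≤ α := by
      have h1 : a ≤ α - m := ha_def ▸ min_le_right _ _
      have h2 : 0 ≤ a * (m * (1 / p).toReal) := by positivity
      linarith
    -- A single pair of bounds `l`, `S` serves all `L`-Lipschitz functions.
    set S : ℝ := max 0 (C * (L : ℝ) ^ m) with hS_def
    have hS0 : 0 ≤ S := le_max_left _ _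
    set l : ℝ := S ^ m⁻¹ with hl_def
    have hl0 : 0 ≤ l := Real.rpow_nonneg hS0 _
    have hsup := supNorm_nonneg φ
    have hlip := lipConst_nonneg φ
    have hα0 : 0 < α := by linarith
    have hK1 : 0 ≤ lipConst φ * (A / α) * l ^ (α - m * (1 - (1 / p).toReal)) *
      S ^ (1 - (1 / p).toReal) := by positivity
    have hK2 : 0 ≤ 2 ^ (a / 2) * supNorm φ * A * l ^ (α - m - a * (1 - m * (1 / p).toReal)) *
      (2 * S) ^ (1 - a * (1 / p).toReal) := by positivity
    have hK3 : 0 ≤ A / α * supNorm φ * l ^ (α - m) * S := by positivity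
    refine ⟨(lipConst φ * (A / α) * l ^ (α - m * (1 - (1 / p).toReal)) *
        S ^ (1 - (1 / p).toReal)) +
      (2 ^ (a / 2) * supNorm φ * A * l ^ (α - m - a * (1 - m * (1 / p).toReal)) *
        (2 * S) ^ (1 - a * (1 / p).toReal)) +
      2 * (A / α * supNorm φ * l ^ (α - m) * S), fun f g hf hg hfL hgL => ?_⟩
    have hTf := (hC.totalPers_le hm0 hq hf hfL).trans (le_max_right 0 _)
    have hTg := (hC.totalPers_le hm0 hq hg hgL).trans (le_max_right 0 _)
    have hpers : ∀ D : Diagram, totalPers m D ≤ S → ∀ r ∈ D, pers r ≤ l := fun D hD r hr =>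
      (Real.le_rpow_inv_iff_of_pos (pers_pos r).le hS0 hm0).2
        ((pers_rpow_le_totalPers m hr).trans hD)
    have hW0 : 0 ≤ wassersteinDist p (dgm f q) (dgm g q) := ENNReal.toReal_nonneg
    have hWa := Real.rpow_nonneg hW0 a
    rcases le_total (wassersteinDist p (dgm f q) (dgm g q)) 1 with hW | hW
    · have hWle : wassersteinDist p (dgm f q) (dgm g q) ≤
          wassersteinDist p (dgm f q) (dgm g q) ^ a := by
        simpa using Real.rpow_le_rpow_of_exponent_ge_of_imp hW0 hW ha1 (by
          intro _ h
          have : 0 < a := ha_def ▸ lt_min one_pos (by linarith)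
          linarith)
      have hmain := norm_representation_sub_le hw hα hA.le hφ_lip hφ_bdd hp1 hm0 hmp ha ha1 haα
        hl0 (hpers _ hTf) (hpers _ hTg) hTf hTg
      have h1 := mul_le_mul_of_nonneg_left hWle hK1
      have h3 := mul_nonneg hK3 hWa
      rw [add_mul, add_mul]
      linarith
    -- Far apart diagrams: the norms of the representations are bounded, and `1 ≤ W ^ a`.
    · have hone := Real.one_le_rpow hW ha
      have hf' := norm_representation_le hw hα hA.le hφ_bdd hm0.le hmα.le (hpers _ hTf) hTf hl0
      have hg' := norm_representation_le hw hα hA.le hφ_bdd hm0.le hmα.le (hpers _ hTg) hTg hl0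
      have hsub := norm_sub_le (representation w φ (dgm f q)) (representation w φ (dgm g q))
      have h1 := mul_nonneg hK1 hWa
      have h2 := mul_nonneg hK2 hWa
      have h3 := mul_le_mul_of_nonneg_left hone hK3
      rw [add_mul, add_mul]
      linarith
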